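/- **Theorem.** There is an absolute constant $C>0$ such that the following holds. Let $1\le k\le d$, $2\le K\le d$, $T$ and $m\ge 1$ be integers, and let $\sigma_h,\sigma_y:\mathbb R\to\mathbb R$ (applied entrywise to vectors) be $1$-Lipschitz with $\sigma_h(0)=\sigma_y(0)=0$ and $|\sigma_h|\le 1$. For a matrix $\mathcal I=[\mathcal I_1,\dots,\mathcal I_k]\in\mathbb R^{k\times k}$, whose columns are $k$ filters of length $k$, and $x\in\mathbb R^d$, let $\mathcal I * x\in\mathbb R^d$ be the average over the $k$ channels of the convolutions of $x$ with the filters: $\mathcal I * x = P\,W_{\mathcal I}\,\bar x$, where $\bar x\in\mathbb R^{d+k-1}$ is $x$ padded with $p$ zeros in front and $k-1-p$ zeros behind (for a fixed $0\le p\le k-1$), $W_{\mathcal I}=[C_1^\top,\dots,C_k^\top]^\top$ with $C_i\in\mathbb R^{d\times(d+k-1)}$ the matrix whose $r$-th row is $\mathcal I_i^\top$ placed at columns $r,\dots,r+k-1$ and zero elsewhere, and $P=\frac1k[I_d\ \cdots\ I_d]$. A convolutional RNN with filter matrices $\mathcal U,\mathcal V,\mathcal W$ computes $$h_0=0,\qquad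 h_t=\sigma_h(\mathcal U * h_{t-1}+\mathcal W * x_t),\qquad y_t=\sigma_y(\mathrm{Pool}(\mathcal V * h_t))\in\mathbb R^K,$$ where $\mathrm{Pool}:\mathbb R^d\to\mathbb R^K$ is a fixed average pooling, i.e. its $j$-th entry is the average of the entries over a fixed nonempty window $A_j\subseteq\{1,\dots,d\}$. Let $\mathcal F_{c,t}$ be the class of all maps $f_t:X_t=(x_1,\dots,x_t)\mapsto y_t$ obtained from filter matrices with $\mathcal U^\top\mathcal U=\mathcal U\mathcal U^\top=\mathcal V^\top\mathcal V=\mathcal V\mathcal V^\top=\mathcal W^\top\mathcal W=\mathcal W\mathcal W^\top=\frac1k I_k$. Let $B_x\ge 0$, let $(x_t,z_t)_{t=1}^T$ follow any distribution on sequences with $x_t\in\mathbb R^d$, $z_t\in\{1,\dots,K\}$ such that almost surely $\|x_t\|_2\le B_x$ for all $t\le T$, and let $S=\{(x_{i,t},z_{i,t})_{t=1}^T : i=1,\dots,m\}$ be an i.i.d. sample from it. Let $\mathcal M(y,z)=y_z-\max_{j\ne z}y_j$, $\mathcal L_\gamma(a)=\mathbf 1\{a>0\}+(1+a/\gamma)\mathbf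 1\{-\gamma\le a\le 0\}$ and $\hat{\mathcal R}_\gamma(f_t)=\frac1m\sum_{i=1}^m\mathcal L_\gamma(-\mathcal M(f_t(X_{i,t}),z_{i,t}))$, where $X_{i,t}=(x_{i,1},\dots,x_{i,t})$. Then for every $\delta\in(0,1)$, with probability at least $1-\delta$ over $S$, simultaneously for every integer $1\le t\le T$, every margin value $\gamma>0$ and every $f_t\in\mathcal F_{c,t}$, $$\mathbb P(\tilde z_t\ne z_t)\ \le\ \hat{\mathcal R}_\gamma(f_t)+C\left(\frac{B_x\,k\,t\,\sqrt{\log(d\,t\sqrt m)}}{\sqrt m\,\gamma}+\sqrt{\frac{\log(1/\delta)}{m}}\right),$$ where $\tilde z_t=\operatorname{argmax}_j [f_t(X_t)]_j$ (with any rule for breaking ties) is the predicted label on a fresh sequence. -/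

import Mathlib

open MeasureTheory

noncomputable section

namespace ConvRNN

/-- The circulant-like matrix generated by a filter `w ∈ ℝᵏ`: row `r` is `w` placed at the columns
`r, r + 1, …, r + k - 1`, all other entries being `0`.  It is used with `l = n - k + 1` rows. -/
def circulantLike {k : ℕ} (l n : ℕ) (w : Fin k → ℝ) : Matrix (Fin l) (Fin n) ℝ :=
  Matrix.of fun r c =>
    if h : (r : ℕ) ≤ c ∧ (c : ℕ) - r < k then w ⟨(c : ℕ) - r, h.2⟩ else 0

/-- `W_𝓘 = [C₁ᵀ, …, C_kᵀ]ᵀ`: the circulant-like matrices of the `k` filters, stacked vertically.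
The filters are the columns of `I`; the row index `(i, r)` is row `r` of block `i`. -/
def stackedConv {k : ℕ} (l n : ℕ) (I : Matrix (Fin k) (Fin k) ℝ) :
    Matrix (Fin k × Fin l) (Fin n) ℝ :=
  Matrix.of fun ir c => circulantLike l n (fun j => I j ir.1) ir.2 c

/-- `P = (1/k) [I_l I_l ⋯ I_l]` (`k` identity blocks): average pooling over the `k` channels. -/
def channelPool (k l : ℕ) : Matrix (Fin l) (Fin k × Fin l) ℝ :=
  Matrix.of fun r is => (1 / (k : ℝ)) * (1 : Matrix (Fin l) (Fin l) ℝ) r is.2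

/-- Zero-padding of `x ∈ ℝᵈ` to length `d + k - 1`: `p` zeros in front of `x`, and the remaining
`k - 1 - p` zeros after it (for `p ≤ k - 1`). -/
def zeroPad {d : ℕ} (k p : ℕ) (x : Fin d → ℝ) : Fin (d + k - 1) → ℝ :=
  fun j => if h : p ≤ (j : ℕ) ∧ (j : ℕ) - p < d then x ⟨(j : ℕ) - p, h.2⟩ else 0

/-- `𝓘 ∗ x = P W_𝓘 x`, with the input zero-padded so that the output has the dimension of `x`. -/
def conv {d k : ℕ} (p : ℕ) (I : Matrix (Fin k) (Fin k) ℝ) (x : Fin d → ℝ) : Fin d → ℝ :=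
  (channelPool k d).mulVec ((stackedConv d (d + k - 1) I).mulVec (zeroPad k p x))

/-- Average pooling from `ℝᵈ` to `ℝᴷ`: output `j` is the average over the window `A j`. -/
def avgPool {d K : ℕ} (A : Fin K → Finset (Fin d)) (v : Fin d → ℝ) : Fin K → ℝ :=
  fun j => (∑ i ∈ A j, v i) / ((A j).card : ℝ)

/-- The filters (columns) are orthogonal with squared norm `1/k`. -/
def IsScaledOrthogonal {k : ℕ} (M : Matrix (Fin k) (Fin k) ℝ) : Prop :=
  M.transpose * M = (1 / (k : ℝ)) • (1 : Matrix (Fin k) (Fin k) ℝ) ∧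
    M * M.transpose = (1 / (k : ℝ)) • (1 : Matrix (Fin k) (Fin k) ℝ)

/-- The hidden state `h_t` after the inputs `x₁, …, x_t`: `h₀ = 0` and
`h_t = σ_h (𝒰 ∗ h_{t-1} + 𝒲 ∗ x_t)`, with `σ_h` applied entrywise. -/
def hidden {d k : ℕ} (p : ℕ) (σh : ℝ → ℝ) (U W : Matrix (Fin k) (Fin k) ℝ) :
    (t : ℕ) → (Fin t → EuclideanSpace ℝ (Fin d)) → Fin d → ℝ
  | 0, _ => 0
  | t + 1, X => fun i =>
      σh (conv p U (hidden p σh U W t (fun s => X s.castSucc)) i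
        + conv p W (X (Fin.last t)).ofLp i)

/-- The `t`-th output `y_t = σ_y (𝒱 ∗ h_t)`, where the convolution is followed by an average pooling
to dimension `K`, and `σ_y` is applied entrywise. -/
def output {d k K : ℕ} (p : ℕ) (A : Fin K → Finset (Fin d)) (σh σy : ℝ → ℝ)
    (U V W : Matrix (Fin k) (Fin k) ℝ) (t : ℕ) (X : Fin t → EuclideanSpace ℝ (Fin d)) :
    Fin K → ℝ :=
  fun j => σy (avgPool A (conv p V (hidden p σh U W t X)) j)

/-- The class of mappings from the first `t` inputs to the `t`-th output computed by Conv RNNs of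
the given architecture whose filter matrices are scaled orthogonal. -/
def convRNNClass {d K : ℕ} (k p : ℕ) (A : Fin K → Finset (Fin d)) (σh σy : ℝ → ℝ) (t : ℕ) :
    Set ((Fin t → EuclideanSpace ℝ (Fin d)) → Fin K → ℝ) :=
  {f | ∃ U V W : Matrix (Fin k) (Fin k) ℝ,
    IsScaledOrthogonal U ∧ IsScaledOrthogonal V ∧ IsScaledOrthogonal W ∧
      f = output p A σh σy U V W t}

/-- The functional margin `y_z - max_{j ≠ z} y_j`. -/
def margin {K : ℕ} (y : Fin K → ℝ) (z : Fin K) : ℝ :=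
  y z - ⨆ j : {j : Fin K // j ≠ z}, y j

/-- The ramp loss `1{a > 0} + (1 + a/γ) 1{-γ ≤ a ≤ 0}`. -/
def rampLoss (γ a : ℝ) : ℝ :=
  (if 0 < a then 1 else 0) + (if -γ ≤ a ∧ a ≤ 0 then 1 + a / γ else 0)

/-- A sequence `(x_s, z_s)_{s = 1}^T` of inputs and labels; index `s : Fin T` is time `s + 1`. -/
abbrev LabeledSeq (d K T : ℕ) : Type := Fin T → EuclideanSpace ℝ (Fin d) × Fin K

/-- The first `t` inputs of a sequence of length `T ≥ t`. -/
def firstInputs {d K T t : ℕ} (ht : t ≤ T) (ω : LabeledSeq d K T) :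
    Fin t → EuclideanSpace ℝ (Fin d) :=
  fun s => (ω (Fin.castLE ht s)).1

/-- The label at time `t`, for `1 ≤ t ≤ T`. -/
def labelAt {d K T t : ℕ} (h1 : 1 ≤ t) (ht : t ≤ T) (ω : LabeledSeq d K T) : Fin K :=
  (ω ⟨t - 1, by omega⟩).2

/-- The empirical ramp risk of `f` at time `t` over the `m` sequences of the sample `S`. -/
def empRampRisk {d K T m t : ℕ} (h1 : 1 ≤ t) (ht : t ≤ T) (γ : ℝ)
    (f : (Fin t → EuclideanSpace ℝ (Fin d)) → Fin K → ℝ) (S : Fin m → LabeledSeq d K T) : ℝ :=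
  (1 / (m : ℝ)) *
    ∑ i, rampLoss γ (-margin (f (firstInputs ht (S i))) (labelAt h1 ht (S i)))

/-- `φ` is a version of `argmax` (an arbitrary way of breaking ties). -/
def IsArgmaxRule {K : ℕ} (φ : (Fin K → ℝ) → Fin K) : Prop :=
  ∀ (y : Fin K → ℝ) (j : Fin K), y j ≤ y (φ y)

/-- The misclassification probability `ℙ (z̃_t ≠ z_t)` of `f` at time `t` on a fresh sequence with
law `μ`, where the predicted label is `z̃_t = φ (f (X_t))`. -/
def errorProb {d K T t : ℕ} (h1 : 1 ≤ t) (ht : t ≤ T) (μ : Measure (LabeledSeq d K T))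
    (φ : (Fin K → ℝ) → Fin K) (f : (Fin t → EuclideanSpace ℝ (Fin d)) → Fin K → ℝ) : ℝ :=
  μ.real {ω | φ (f (firstInputs ht ω)) ≠ labelAt h1 ht ω}

end ConvRNN

end

/-! The proof is a union bound over a finite net, resting on the fact that averaging over channels
leaves only `k` effective parameters per filter matrix. The map `conv p I` correlates the padded
signal with the averaged filter `avgFilter I`. Orthogonality bounds each of its entries by `1/k`, so
its ℓ¹ norm is at most `1` and convolution is nonexpansive in the sup norm (`abs_avgFilter_le`,
`abs_conv_le`). Outputs at time `t` are therefore at most `t B`, and an ℓ¹ error `ε` in the three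
averaged filters moves them by at most `2 ε B t²` (`abs_output_sub_le`).

With `M` the margin divided by `2 B t` and `s = 2 B t / γ`, we have `|M| ≤ 1` and the ramp loss is
`clip (1 - s M)`. A grid of kernels and of slopes `s`, with Hoeffding's inequality at each grid
point, controls all networks with `1 ≤ s ≤ m` (`exists_net_event`, `integral_clip_le_of_one_le`).
Since the net does not depend on `γ`, a single event serves all margins.

The remaining slopes need no net. For `s ≤ 1` the loss is affine in the loss of slope `1`, so its
deviation shrinks by the factor `s`, as the term in `1/γ` requires (`integral_clip_le`). For `s > m`
the right-hand side exceeds `1`. If `B = 0`, all margins vanish and the empirical risk is `1`. -/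

namespace ConvRNN

/-! ### Hoeffding's inequality and a weighted union bound -/

section Deviation

open ProbabilityTheory

/-- **Hoeffding's inequality** for the empirical mean of a `[0, 1]`-valued function over an i.i.d.
sample. -/
theorem measureReal_empMean_add_lt_integral_le {Ω : Type*} [MeasurableSpace Ω] (μ : Measure Ω)
    [IsProbabilityMeasure μ] {m : ℕ} (hm : 1 ≤ m) {g : Ω → ℝ} (hg : Measurable g)
    (h01 : ∀ ω, g ω ∈ Set.Icc (0 : ℝ) 1) {η : ℝ} (hη : 0 ≤ η) :
    (Measure.pi fun _ : Fin m => μ).real {S | (1 / (m : ℝ)) * ∑ i, g (S i) + η < ∫ ω, g ω ∂μ} ≤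
      Real.exp (-(2 * m * η ^ 2)) := by
  have hm0 : (0 : ℝ) < m := by exact_mod_cast hm
  have hX : HasSubgaussianMGF (fun ω => -(g ω - ∫ ω, g ω ∂μ)) ((‖(1 : ℝ) - 0‖₊ / 2) ^ 2) μ :=
    (hasSubgaussianMGF_of_mem_Icc hg.aemeasurable (ae_of_all _ h01)).neg
  set X : Ω → ℝ := fun ω => -(g ω - ∫ ω, g ω ∂μ) with hXdef
  have hXm : Measurable X := (hg.sub_const _).neg
  have hind : iIndepFun (fun (i : Fin m) (S : Fin m → Ω) => X (S i))
      (Measure.pi fun _ : Fin m => μ) := iIndepFun_pi fun _ => hXm.aemeasurable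
  have hsub : ∀ i ∈ (Finset.univ : Finset (Fin m)),
      HasSubgaussianMGF (fun S : Fin m → Ω => X (S i)) ((‖(1 : ℝ) - 0‖₊ / 2) ^ 2)
        (Measure.pi fun _ : Fin m => μ) := by
    intro i _
    have hmp := measurePreserving_eval (fun _ : Fin m => μ) i
    refine HasSubgaussianMGF.of_map (X := X) (Y := fun S : Fin m → Ω => S i)
      hmp.measurable.aemeasurable ?_
    rw [hmp.map_eq]
    exact hX
  -- Each summand has variance proxy `1/4`, so the exponent is `-(m η)² / (2 · m/4) = -2 m η²`.
  have key := HasSubgaussianMGF.measure_sum_ge_le_of_iIndepFun hind hsub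
    (ε := m * η) (by positivity)
  refine (measureReal_mono ?_).trans (key.trans (Real.exp_le_exp.2 (le_of_eq ?_)))
  · intro S hS
    simp only [Set.mem_ofPred_eq, hXdef, neg_sub, Finset.sum_sub_distrib, Finset.sum_const,
      Finset.card_univ, Fintype.card_fin, nsmul_eq_mul] at hS ⊢
    have h1 := mul_lt_mul_of_pos_left hS hm0
    have h2 : (m : ℝ) * (1 / (m : ℝ) * ∑ i, g (S i) + η) = ∑ i, g (S i) + m * η := by
      field_simp
    linarith
  · simp
    field_simp

/-- Simultaneous deviation bound for a finite family of `[0, 1]`-valued functions, with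
failure probability distributed over the family according to weights. -/
theorem exists_uniform_deviation_event {Ω : Type*} [MeasurableSpace Ω] (μ : Measure Ω)
    [IsProbabilityMeasure μ] {m : ℕ} (hm : 1 ≤ m) {ι : Type*} [Fintype ι] {g : ι → Ω → ℝ}
    (hg : ∀ i, Measurable (g i)) (h01 : ∀ i ω, g i ω ∈ Set.Icc (0 : ℝ) 1) {q : ι → ℝ}
    (hq0 : ∀ i, 1 ≤ q i) (hq : ∑ i, (q i)⁻¹ ≤ 1) {δ : ℝ} (hδ0 : 0 < δ) (hδ1 : δ < 1) :
    ∃ E : Set (Fin m → Ω), MeasurableSet E ∧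
      1 - δ ≤ (Measure.pi fun _ : Fin m => μ).real E ∧
      ∀ S ∈ E, ∀ i, ∫ ω, g i ω ∂μ ≤
        (1 / (m : ℝ)) * ∑ j, g i (S j) + √(Real.log (q i / δ) / (2 * m)) := by
  have hm0 : (0 : ℝ) < m := by exact_mod_cast hm
  set bad : ι → Set (Fin m → Ω) := fun i =>
    {S | (1 / (m : ℝ)) * ∑ j, g i (S j) + √(Real.log (q i / δ) / (2 * m)) < ∫ ω, g i ω ∂μ}
    with hbad
  have hmeas : ∀ i, MeasurableSet (bad i) := by
    intro i
    refine measurableSet_lt ?_ measurable_const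
    exact ((Finset.measurable_sum _ fun j _ =>
      (hg i).comp (measurable_pi_apply j)).const_mul _).add_const _
  -- The deviation is chosen so that `exp (-2 m η²)` is exactly `δ / q i`; the weights make these
  -- sum to at most `δ`.
  have hprob : ∀ i, (Measure.pi fun _ : Fin m => μ).real (bad i) ≤ δ * (q i)⁻¹ := by
    intro i
    have hq' : 0 < q i := lt_of_lt_of_le one_pos (hq0 i)
    have hlog : 0 ≤ Real.log (q i / δ) :=
      Real.log_nonneg ((one_le_div hδ0).2 (hδ1.le.trans (hq0 i)))
    refine (measureReal_empMean_add_lt_integral_le μ hm (hg i) (h01 i)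
      (Real.sqrt_nonneg _)).trans (le_of_eq ?_)
    rw [Real.sq_sqrt (by positivity), mul_div_cancel₀ _ (by positivity), Real.exp_neg,
      Real.exp_log (by positivity)]
    field_simp
  refine ⟨(⋃ i, bad i)ᶜ, (MeasurableSet.iUnion hmeas).compl, ?_, ?_⟩
  · rw [probReal_compl_eq_one_sub (MeasurableSet.iUnion hmeas)]
    have h1 : (Measure.pi fun _ : Fin m => μ).real (⋃ i, bad i) ≤ ∑ i, δ * (q i)⁻¹ :=
      (measureReal_iUnion_fintype_le bad).trans (Finset.sum_le_sum fun i _ => hprob i)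
    rw [← Finset.mul_sum] at h1
    nlinarith
  · intro S hS i
    by_contra h
    exact hS (Set.mem_iUnion.2 ⟨i, not_le.1 h⟩)

end Deviation

/-! ### The ramp loss as a truncated affine function -/

section Clip

/-- Truncation of a real number to `[0, 1]`. -/
noncomputable def clip (x : ℝ) : ℝ := min 1 (max 0 x)

theorem clip_mem_Icc (x : ℝ) : clip x ∈ Set.Icc (0 : ℝ) 1 :=
  ⟨le_min zero_le_one (le_max_left _ _), min_le_left _ _⟩

theorem clip_le_add_abs_sub (x y : ℝ) : clip x ≤ clip y + |x - y| := by
  have h := le_abs_self (x - y)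
  have h0 := abs_nonneg (x - y)
  unfold clip
  rcases le_total 0 x with hx | hx <;> rcases le_total 0 y with hy | hy <;>
    simp only [max_eq_left, max_eq_right, hx, hy] <;>
    rcases le_total 1 x with hx1 | hx1 <;> rcases le_total 1 y with hy1 | hy1 <;>
    simp [*] <;> linarith

theorem clip_eq_self {x : ℝ} (h0 : 0 ≤ x) (h1 : x ≤ 1) : clip x = x := by
  simp [clip, h0, h1]

theorem clip_eq_one {x : ℝ} (h1 : 1 ≤ x) : clip x = 1 := by
  simp [clip, h1, zero_le_one.trans h1]

theorem continuous_clip : Continuous clip := by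
  unfold clip
  fun_prop

theorem rampLoss_eq_clip {γ : ℝ} (hγ : 0 < γ) (a : ℝ) : rampLoss γ a = clip (1 + a / γ) := by
  unfold rampLoss clip
  rcases lt_or_ge 0 a with ha | ha
  · have : 0 < a / γ := div_pos ha hγ
    rw [if_pos ha, if_neg (by simp [ha]), max_eq_right (by linarith), min_eq_left (by linarith)]
    simp
  · have h1 : a / γ ≤ 0 := div_nonpos_of_nonpos_of_nonneg ha hγ.le
    rw [if_neg (not_lt.2 ha)]
    by_cases hb : -γ ≤ a
    · have : -1 ≤ a / γ := by rw [le_div_iff₀ hγ]; linarith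
      rw [if_pos ⟨hb, ha⟩, max_eq_right (by linarith), min_eq_right (by linarith)]
      simp
    · have : a / γ ≤ -1 := by rw [div_le_iff₀ hγ]; linarith
      rw [if_neg (by simp [hb]), max_eq_left (by linarith), min_eq_right (by linarith)]
      simp

end Clip

/-! ### Margins: Lipschitz dependence on the scores, sign, measurability -/

section Margin

variable {K : ℕ}

theorem nonempty_ne (hK : 2 ≤ K) (z : Fin K) : Nonempty {j : Fin K // j ≠ z} := by
  have : Nontrivial (Fin K) := Fin.nontrivial_iff_two_le.2 hK
  obtain ⟨j, hj⟩ := exists_ne z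
  exact ⟨⟨j, hj⟩⟩

theorem margin_le_margin_add (hK : 2 ≤ K) {y y' : Fin K → ℝ} {e : ℝ}
    (h : ∀ j, |y j - y' j| ≤ e) (z : Fin K) : margin y z ≤ margin y' z + 2 * e := by
  have := nonempty_ne hK z
  have h1 : (⨆ j : {j : Fin K // j ≠ z}, y' j) ≤ (⨆ j : {j : Fin K // j ≠ z}, y j) + e := by
    refine ciSup_le fun j => ?_
    have h2 := le_ciSup (Set.finite_range fun j : {j : Fin K // j ≠ z} => y j).bddAbove j
    have h3 := (abs_le.1 (h j)).1
    linarith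
  have h4 := (abs_le.1 (h z)).2
  unfold margin
  linarith

theorem abs_margin_sub_margin_le (hK : 2 ≤ K) {y y' : Fin K → ℝ} {e : ℝ}
    (h : ∀ j, |y j - y' j| ≤ e) (z : Fin K) : |margin y z - margin y' z| ≤ 2 * e := by
  rw [abs_le]
  have h1 := margin_le_margin_add hK h z
  have h2 := margin_le_margin_add hK (fun j => (abs_sub_comm (y' j) (y j)).trans_le (h j)) z
  constructor <;> linarith

theorem abs_margin_le (hK : 2 ≤ K) {y : Fin K → ℝ} {e : ℝ} (h : ∀ j, |y j| ≤ e) (z : Fin K) :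
    |margin y z| ≤ 2 * e := by
  have := nonempty_ne hK z
  have h0 : margin (fun _ : Fin K => (0 : ℝ)) z = 0 := by simp [margin]
  simpa [h0] using abs_margin_sub_margin_le hK (y' := fun _ => 0) (by simpa using h) z

theorem margin_nonpos_of_argmax_ne {φ : (Fin K → ℝ) → Fin K} (hφ : IsArgmaxRule φ)
    {y : Fin K → ℝ} {z : Fin K} (h : φ y ≠ z) : margin y z ≤ 0 := by
  have h2 := le_ciSup (Set.finite_range fun j : {j : Fin K // j ≠ z} => y j).bddAbove ⟨φ y, h⟩
  have h3 := hφ y z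
  unfold margin
  linarith

theorem measurable_margin : Measurable fun q : (Fin K → ℝ) × Fin K => margin q.1 q.2 := by
  refine measurable_from_prod_countable_left fun z => ?_
  have h : Measurable fun y : Fin K → ℝ => ⨆ j : {j : Fin K // j ≠ z}, y j :=
    Measurable.iSup fun j => measurable_pi_apply _
  exact (measurable_pi_apply z).sub h

end Margin

/-! ### Averaged filters and sup-norm bounds for the convolution -/

/-- The kernel by which `conv` with the filter matrix `I` acts: the average of the filters. -/
noncomputable def avgFilter {k : ℕ} (I : Matrix (Fin k) (Fin k) ℝ) : Fin k → ℝ :=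
  fun j => (1 / (k : ℝ)) * ∑ i, I j i

/-- The filter matrix all of whose filters are `w`. -/
noncomputable def constFilter {k : ℕ} (w : Fin k → ℝ) : Matrix (Fin k) (Fin k) ℝ :=
  Matrix.of fun j _ => w j

theorem avgFilter_constFilter {k : ℕ} (w : Fin k → ℝ) : avgFilter (constFilter w) = w := by
  funext j
  have hk : (k : ℝ) ≠ 0 := by
    have := j.pos
    positivity
  simp [avgFilter, constFilter, hk]

/-- Row `j` of `I` has squared norm `1/k`, so by Cauchy–Schwarz its `k` entries sum to at most `1`
in absolute value; averaging contributes the factor `1/k`. -/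
theorem abs_avgFilter_le {k : ℕ} {I : Matrix (Fin k) (Fin k) ℝ} (hI : IsScaledOrthogonal I)
    (j : Fin k) : |avgFilter I j| ≤ 1 / k := by
  have hk : (0 : ℝ) < k := by exact_mod_cast j.pos
  have hrow : ∑ i, I j i ^ 2 = 1 / k := by
    have h := congrFun (congrFun hI.2 j) j
    simp only [Matrix.mul_apply, Matrix.transpose_apply, Matrix.smul_apply, Matrix.one_apply_eq,
      smul_eq_mul, mul_one] at h
    simpa [pow_two] using h
  have hsq : (∑ i, I j i) ^ 2 ≤ 1 := by
    have h := sq_sum_le_card_mul_sum_sq (s := Finset.univ) (f := fun i => I j i)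
    rw [hrow] at h
    simpa [hk.ne'] using h
  unfold avgFilter
  rw [abs_mul, abs_of_pos (by positivity : 0 < 1 / (k : ℝ))]
  exact mul_le_of_le_one_right (by positivity) ((sq_le_one_iff_abs_le_one _).1 hsq)

theorem sum_abs_le_one {k : ℕ} {w : Fin k → ℝ} (hw : ∀ j, |w j| ≤ 1 / k) : ∑ j, |w j| ≤ 1 := by
  refine (Finset.sum_le_sum fun j _ => hw j).trans ?_
  rcases Nat.eq_zero_or_pos k with rfl | hk
  · simp
  · have : (k : ℝ) ≠ 0 := by positivity
    simp [this]

section Conv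

variable {d k : ℕ} {p : ℕ}

theorem circulantLike_mulVec {l n : ℕ} (w : Fin k → ℝ) (x : Fin n → ℝ) (r : Fin l)
    (hn : l + k - 1 ≤ n) :
    ∑ c, circulantLike l n w r c * x c =
      ∑ j : Fin k, w j * x ⟨r + j, by have := r.2; have := j.2; omega⟩ := by
  symm
  refine Finset.sum_of_injOn (fun j : Fin k => (⟨r + j, by have := r.2; have := j.2; omega⟩ : Fin n))
    ?_ ?_ ?_ ?_
  · intro a _ b _ h
    simp only [Fin.mk.injEq] at h
    exact Fin.ext (by omega)
  · simp
  · intro c _ hc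
    unfold circulantLike
    simp only [Matrix.of_apply]
    rw [dif_neg, zero_mul]
    rintro ⟨h1, h2⟩
    exact hc ⟨⟨c - r, h2⟩, by simp, Fin.ext (by simp; omega)⟩
  · intro j _
    simp [circulantLike]

/-- Everything after this formula sees `I` only through `avgFilter I`. Hence the net can live in
`ℝᵏ` and need not consist of orthogonal matrices. -/
theorem conv_apply (I : Matrix (Fin k) (Fin k) ℝ) (x : Fin d → ℝ) (r : Fin d) :
    conv p I x r =
      ∑ j : Fin k, avgFilter I j *
        zeroPad k p x ⟨r + j, by have := r.2; have := j.2; omega⟩ := by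
  unfold conv channelPool stackedConv
  simp only [Matrix.mulVec, dotProduct, Matrix.of_apply, Fintype.sum_prod_type]
  simp_rw [circulantLike_mulVec _ _ _ le_rfl]
  simp only [Matrix.one_apply, mul_ite, mul_one, mul_zero, ite_mul, zero_mul, Finset.sum_ite_eq,
    Finset.mem_univ, if_true, avgFilter]
  rw [← Finset.mul_sum, Finset.sum_comm, Finset.mul_sum]
  refine Finset.sum_congr rfl fun j _ => ?_
  rw [← Finset.sum_mul, mul_assoc]

theorem abs_zeroPad_le {x : Fin d → ℝ} {c : ℝ} (hc : 0 ≤ c) (hx : ∀ i, |x i| ≤ c)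
    (j : Fin (d + k - 1)) : |zeroPad k p x j| ≤ c := by
  unfold zeroPad
  split
  · exact hx _
  · simpa using hc

theorem zeroPad_sub (x x' : Fin d → ℝ) (j : Fin (d + k - 1)) :
    zeroPad k p (x - x') j = zeroPad k p x j - zeroPad k p x' j := by
  unfold zeroPad
  split <;> simp

theorem continuous_conv (I : Matrix (Fin k) (Fin k) ℝ) :
    Continuous (conv p I : (Fin d → ℝ) → Fin d → ℝ) := by
  unfold conv
  have h : Continuous fun x : Fin d → ℝ => zeroPad k p x := by
    refine continuous_pi fun j => ?_
    unfold zeroPad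
    split <;> fun_prop
  fun_prop

theorem abs_conv_le {I : Matrix (Fin k) (Fin k) ℝ} {x : Fin d → ℝ} {b c : ℝ}
    (hI : ∑ j, |avgFilter I j| ≤ b) (hc : 0 ≤ c) (hx : ∀ i, |x i| ≤ c) (r : Fin d) :
    |conv p I x r| ≤ b * c := by
  rw [conv_apply]
  refine (Finset.abs_sum_le_sum_abs _ _).trans ?_
  calc _ ≤ ∑ j, |avgFilter I j| * c := by
        refine Finset.sum_le_sum fun j _ => ?_
        rw [abs_mul]
        exact mul_le_mul_of_nonneg_left (abs_zeroPad_le hc hx _) (abs_nonneg _)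
    _ ≤ b * c := by
        rw [← Finset.sum_mul]
        exact mul_le_mul_of_nonneg_right hI hc

theorem conv_sub_right (I : Matrix (Fin k) (Fin k) ℝ) (x x' : Fin d → ℝ) (r : Fin d) :
    conv p I (x - x') r = conv p I x r - conv p I x' r := by
  simp [conv_apply, zeroPad_sub, mul_sub, Finset.sum_sub_distrib]

theorem avgFilter_sub (I I' : Matrix (Fin k) (Fin k) ℝ) (j : Fin k) :
    avgFilter (I - I') j = avgFilter I j - avgFilter I' j := by
  simp [avgFilter, Finset.sum_sub_distrib, mul_sub]

theorem conv_sub_left (I I' : Matrix (Fin k) (Fin k) ℝ) (x : Fin d → ℝ) (r : Fin d) :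
    conv p (I - I') x r = conv p I x r - conv p I' x r := by
  simp [conv_apply, avgFilter_sub, sub_mul, Finset.sum_sub_distrib]

/-- `conv` is nonexpansive in the signal and Lipschitz in the averaged filter, for sup-norms. -/
theorem abs_conv_sub_conv_le {I I' : Matrix (Fin k) (Fin k) ℝ} {x x' : Fin d → ℝ} {ε c e : ℝ}
    (hI : ∑ j, |avgFilter I j| ≤ 1) (hII : ∑ j, |avgFilter I j - avgFilter I' j| ≤ ε)
    (hc : 0 ≤ c) (he : 0 ≤ e) (hx' : ∀ i, |x' i| ≤ c) (hxx : ∀ i, |x i - x' i| ≤ e) (r : Fin d) :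
    |conv p I x r - conv p I' x' r| ≤ e + ε * c := by
  have h1 : |conv p I (x - x') r| ≤ 1 * e := abs_conv_le hI he hxx r
  have h2 : |conv p (I - I') x' r| ≤ ε * c :=
    abs_conv_le (by simpa only [avgFilter_sub] using hII) hc hx' r
  have h3 : conv p I x r - conv p I' x' r = conv p I (x - x') r + conv p (I - I') x' r := by
    rw [conv_sub_right, conv_sub_left]
    ring
  rw [h3]
  exact (abs_add_le _ _).trans (by linarith)

end Conv

/-! ### Size, stability and measurability of the network -/

section Network

variable {d k K p : ℕ} {σh σy : ℝ → ℝ} {A : Fin K → Finset (Fin d)}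

theorem abs_sub_le_of_lipschitz {σ : ℝ → ℝ} (hσ : LipschitzWith 1 σ) (a b : ℝ) :
    |σ a - σ b| ≤ |a - b| := by
  simpa [Real.dist_eq] using hσ.dist_le_mul a b

theorem abs_le_of_lipschitz {σ : ℝ → ℝ} (hσ : LipschitzWith 1 σ) (h0 : σ 0 = 0) (a : ℝ) :
    |σ a| ≤ |a| := by
  simpa [h0] using abs_sub_le_of_lipschitz hσ a 0

theorem abs_avgPool_le {v : Fin d → ℝ} {c : ℝ} (hA : ∀ j, (A j).Nonempty)
    (hv : ∀ i, |v i| ≤ c) (j : Fin K) : |avgPool A v j| ≤ c := by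
  have hpos : (0 : ℝ) < (A j).card := by exact_mod_cast (hA j).card_pos
  unfold avgPool
  rw [abs_div, abs_of_pos hpos, div_le_iff₀ hpos]
  calc _ ≤ ∑ i ∈ A j, |v i| := Finset.abs_sum_le_sum_abs _ _
    _ ≤ ∑ i ∈ A j, c := Finset.sum_le_sum fun i _ => hv i
    _ = c * (A j).card := by simp [mul_comm]

theorem avgPool_sub (v v' : Fin d → ℝ) (j : Fin K) :
    avgPool A (v - v') j = avgPool A v j - avgPool A v' j := by
  simp [avgPool, Finset.sum_sub_distrib, sub_div]

theorem abs_entry_le_of_norm_le {x : EuclideanSpace ℝ (Fin d)} {B : ℝ} (h : ‖x‖ ≤ B) (i : Fin d) :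
    |x.ofLp i| ≤ B :=
  (PiLp.norm_apply_le x i).trans h

theorem abs_hidden_le (hσ : LipschitzWith 1 σh) (h0 : σh 0 = 0)
    {U W : Matrix (Fin k) (Fin k) ℝ} (hU : ∑ j, |avgFilter U j| ≤ 1)
    (hW : ∑ j, |avgFilter W j| ≤ 1) {B : ℝ} (hB : 0 ≤ B) :
    ∀ (t : ℕ) (X : Fin t → EuclideanSpace ℝ (Fin d)), (∀ s, ‖X s‖ ≤ B) →
      ∀ i, |hidden p σh U W t X i| ≤ t * B
  | 0, _, _, i => by simp [hidden]
  | t + 1, X, hX, i => by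
      have ih := abs_hidden_le hσ h0 hU hW hB t (fun s => X s.castSucc) fun s => hX _
      have h1 := abs_conv_le (p := p) hU (by positivity) ih i
      have h2 := abs_conv_le (p := p) hW hB (abs_entry_le_of_norm_le (hX (Fin.last t))) i
      simp only [hidden]
      refine (abs_le_of_lipschitz hσ h0 _).trans ((abs_add_le _ _).trans ?_)
      push_cast
      linarith

theorem abs_output_le (hA : ∀ j, (A j).Nonempty) (hσh : LipschitzWith 1 σh) (hh0 : σh 0 = 0)
    (hσy : LipschitzWith 1 σy) (hy0 : σy 0 = 0) {U V W : Matrix (Fin k) (Fin k) ℝ}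
    (hU : ∑ j, |avgFilter U j| ≤ 1) (hV : ∑ j, |avgFilter V j| ≤ 1)
    (hW : ∑ j, |avgFilter W j| ≤ 1) {B : ℝ} (hB : 0 ≤ B) {t : ℕ}
    {X : Fin t → EuclideanSpace ℝ (Fin d)} (hX : ∀ s, ‖X s‖ ≤ B) (j : Fin K) :
    |output p A σh σy U V W t X j| ≤ t * B := by
  refine (abs_le_of_lipschitz hσy hy0 _).trans (abs_avgPool_le hA (fun i => ?_) j)
  simpa using abs_conv_le (p := p) hV (by positivity) (abs_hidden_le hσh hh0 hU hW hB t X hX) i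

/-- One time step adds `ε t B` from changing `U` (the state is at most `t B`) and `ε B` from
changing `W`, while the previous error is not amplified; `t² + t + 1 ≤ (t + 1)²` closes the
induction. -/
theorem abs_hidden_sub_le (hσ : LipschitzWith 1 σh) (h0 : σh 0 = 0)
    {U W U' W' : Matrix (Fin k) (Fin k) ℝ} (hU : ∑ j, |avgFilter U j| ≤ 1)
    (hW : ∑ j, |avgFilter W j| ≤ 1) (hU' : ∑ j, |avgFilter U' j| ≤ 1)
    (hW' : ∑ j, |avgFilter W' j| ≤ 1) {ε : ℝ} (hε : 0 ≤ ε)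
    (hUU : ∑ j, |avgFilter U j - avgFilter U' j| ≤ ε)
    (hWW : ∑ j, |avgFilter W j - avgFilter W' j| ≤ ε) {B : ℝ} (hB : 0 ≤ B) :
    ∀ (t : ℕ) (X : Fin t → EuclideanSpace ℝ (Fin d)), (∀ s, ‖X s‖ ≤ B) →
      ∀ i, |hidden p σh U W t X i - hidden p σh U' W' t X i| ≤ ε * B * t ^ 2
  | 0, _, _, i => by simp [hidden]
  | t + 1, X, hX, i => by
      have ih := abs_hidden_sub_le hσ h0 hU hW hU' hW' hε hUU hWW hB t (fun s => X s.castSucc)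
        fun s => hX _
      have hb := abs_hidden_le (p := p) hσ h0 hU' hW' hB t (fun s => X s.castSucc) fun s => hX _
      have h1 := abs_conv_sub_conv_le (p := p) hU hUU (by positivity) (by positivity) hb ih i
      have h2 := abs_conv_sub_conv_le (p := p) hW hWW hB le_rfl
        (abs_entry_le_of_norm_le (hX (Fin.last t))) (x := (X (Fin.last t)).ofLp) (by simp) i
      simp only [hidden]
      refine (abs_sub_le_of_lipschitz hσ _ _).trans ?_
      rw [add_sub_add_comm]
      refine (abs_add_le _ _).trans ((add_le_add h1 h2).trans ?_)
      push_cast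
      have : 0 ≤ ε * B * t := by positivity
      nlinarith

theorem abs_output_sub_le (hA : ∀ j, (A j).Nonempty) (hσh : LipschitzWith 1 σh) (hh0 : σh 0 = 0)
    (hσy : LipschitzWith 1 σy) {U V W U' V' W' : Matrix (Fin k) (Fin k) ℝ}
    (hU : ∑ j, |avgFilter U j| ≤ 1) (hV : ∑ j, |avgFilter V j| ≤ 1)
    (hW : ∑ j, |avgFilter W j| ≤ 1) (hU' : ∑ j, |avgFilter U' j| ≤ 1)
    (hW' : ∑ j, |avgFilter W' j| ≤ 1) {ε : ℝ} (hε : 0 ≤ ε)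
    (hUU : ∑ j, |avgFilter U j - avgFilter U' j| ≤ ε)
    (hVV : ∑ j, |avgFilter V j - avgFilter V' j| ≤ ε)
    (hWW : ∑ j, |avgFilter W j - avgFilter W' j| ≤ ε) {B : ℝ} (hB : 0 ≤ B) {t : ℕ}
    {X : Fin t → EuclideanSpace ℝ (Fin d)} (hX : ∀ s, ‖X s‖ ≤ B) (j : Fin K) :
    |output p A σh σy U V W t X j - output p A σh σy U' V' W' t X j| ≤
      2 * ε * B * t ^ 2 := by
  refine (abs_sub_le_of_lipschitz hσy _ _).trans ?_
  rw [← avgPool_sub]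
  refine abs_avgPool_le hA (fun i => ?_) j
  refine (abs_conv_sub_conv_le (p := p) hV hVV (by positivity) (by positivity)
    (abs_hidden_le hσh hh0 hU' hW' hB t X hX)
    (abs_hidden_sub_le hσh hh0 hU hW hU' hW' hε hUU hWW hB t X hX) i).trans ?_
  have h1 : (t : ℝ) ≤ (t : ℝ) ^ 2 := by exact_mod_cast Nat.le_self_pow two_ne_zero t
  have h2 := mul_le_mul_of_nonneg_left h1 (mul_nonneg hε hB)
  nlinarith

theorem continuous_hidden (hσ : LipschitzWith 1 σh) (U W : Matrix (Fin k) (Fin k) ℝ) :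
    ∀ t : ℕ, Continuous (hidden (d := d) p σh U W t)
  | 0 => continuous_const
  | t + 1 => by
      have ih := continuous_hidden hσ U W t
      refine continuous_pi fun i => hσ.continuous.comp (Continuous.add ?_ ?_)
      · refine (continuous_apply i).comp ((continuous_conv U).comp (ih.comp ?_))
        exact continuous_pi fun s => continuous_apply _
      · refine (continuous_apply i).comp ((continuous_conv W).comp ?_)
        exact (PiLp.continuous_ofLp 2 _).comp (continuous_apply _)

theorem continuous_output (hσh : LipschitzWith 1 σh) (hσy : LipschitzWith 1 σy)
    (U V W : Matrix (Fin k) (Fin k) ℝ) (t : ℕ) : Continuous (output p A σh σy U V W t) := by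
  have h := (continuous_conv (d := d) (p := p) V).comp (continuous_hidden (p := p) hσh U W t)
  refine continuous_pi fun j => hσy.continuous.comp ?_
  unfold avgPool
  refine Continuous.div_const (continuous_finsetSum _ fun i _ => ?_) _
  exact (continuous_apply i).comp h

theorem measurable_firstInputs {T t : ℕ} (ht : t ≤ T) :
    Measurable (firstInputs (d := d) (K := K) ht) :=
  measurable_pi_lambda _ fun _ => measurable_fst.comp (measurable_pi_apply _)

theorem measurable_labelAt {T t : ℕ} (h1 : 1 ≤ t) (ht : t ≤ T) :
    Measurable (labelAt (d := d) (K := K) h1 ht) :=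
  measurable_snd.comp (measurable_pi_apply _)

end Network

/-! ### A finite ℓ¹-net of kernels -/

section Net

/-- The grid of kernels with entries `-1/k + a / (k n)`, `a = 0, …, 2n`. -/
noncomputable def gridFilter {k : ℕ} (n : ℕ) (a : Fin k → Fin (2 * n + 1)) : Fin k → ℝ :=
  fun j => (1 / (k : ℝ)) * ((a j : ℕ) / (n : ℝ) - 1)

theorem abs_gridFilter_le {k n : ℕ} (hn : 1 ≤ n) (a : Fin k → Fin (2 * n + 1)) (j : Fin k) :
    |gridFilter n a j| ≤ 1 / k := by
  have hn0 : (0 : ℝ) < n := by exact_mod_cast hn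
  have ha : ((a j : ℕ) : ℝ) ≤ 2 * n := by exact_mod_cast Nat.lt_succ_iff.1 (a j).2
  unfold gridFilter
  rw [abs_mul, abs_of_nonneg (by positivity : 0 ≤ 1 / (k : ℝ))]
  refine mul_le_of_le_one_right (by positivity) (abs_le.2 ⟨?_, ?_⟩)
  · have : 0 ≤ ((a j : ℕ) : ℝ) / n := by positivity
    linarith
  · have : ((a j : ℕ) : ℝ) / n ≤ 2 := by rwa [div_le_iff₀ hn0]
    linarith

/-- Rounding `k w j + 1 ∈ [0, 2]` down to a multiple of `1/n` costs at most `1/(k n)` per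
coordinate, and there are `k` coordinates. -/
theorem exists_gridFilter_near {k n : ℕ} (hn : 1 ≤ n) {w : Fin k → ℝ} (hw : ∀ j, |w j| ≤ 1 / k) :
    ∃ a : Fin k → Fin (2 * n + 1), ∑ j, |w j - gridFilter n a j| ≤ 1 / n := by
  have hn0 : (0 : ℝ) < n := by exact_mod_cast hn
  have key : ∀ j, ∃ b : Fin (2 * n + 1),
      |w j - (1 / (k : ℝ)) * ((b : ℕ) / (n : ℝ) - 1)| ≤ 1 / k * (1 / n) := by
    intro j
    have hk : (0 : ℝ) < k := by exact_mod_cast j.pos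
    have hwj := abs_le.1 (hw j)
    have hkw1 : k * w j ≤ 1 := by
      have := mul_le_mul_of_nonneg_left hwj.2 hk.le
      rwa [mul_one_div_cancel hk.ne'] at this
    have hkw0 : -1 ≤ k * w j := by
      have := mul_le_mul_of_nonneg_left hwj.1 hk.le
      rwa [mul_neg, mul_one_div_cancel hk.ne'] at this
    have hv0 : 0 ≤ (k * w j + 1) * n := by apply mul_nonneg <;> linarith
    have hv2 : (k * w j + 1) * n ≤ ((2 * n : ℕ) : ℝ) := by push_cast; nlinarith
    have hle := Nat.floor_le hv0
    have hlt := Nat.lt_floor_add_one ((k * w j + 1) * n)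
    refine ⟨⟨⌊(k * w j + 1) * n⌋₊, Nat.lt_succ_of_le (Nat.floor_le_of_le hv2)⟩, ?_⟩
    simp only
    set f : ℝ := (⌊(k * w j + 1) * n⌋₊ : ℝ)
    have e : w j - 1 / (k : ℝ) * (f / n - 1) = 1 / k * (1 / n) * ((k * w j + 1) * n - f) := by
      field_simp
      ring
    rw [e, abs_mul, abs_of_pos (by positivity : 0 < 1 / (k : ℝ) * (1 / n))]
    exact mul_le_of_le_one_right (by positivity) (abs_le.2 ⟨by linarith, by linarith⟩)
  choose a ha using key
  refine ⟨a, (Finset.sum_le_sum fun j _ => ha j).trans ?_⟩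
  rcases Nat.eq_zero_or_pos k with rfl | hk
  · simp
  · have : (k : ℝ) ≠ 0 := by positivity
    simp [this]

end Net

/-! ### Transfer from net points to arbitrary losses -/

section Reduction

theorem integral_le_empMean_add_of_near {Ω : Type*} [MeasurableSpace Ω] {μ : Measure Ω}
    [IsProbabilityMeasure μ] {m : ℕ} (hm : 1 ≤ m) {g g' : Ω → ℝ} (hg : Integrable g μ)
    (hg' : Integrable g' μ) {e η : ℝ} (h1 : ∀ᵐ ω ∂μ, g ω ≤ g' ω + e) {S : Fin m → Ω}
    (h2 : ∀ j, g' (S j) ≤ g (S j) + e)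
    (h3 : ∫ ω, g' ω ∂μ ≤ (1 / (m : ℝ)) * ∑ j, g' (S j) + η) :
    ∫ ω, g ω ∂μ ≤ (1 / (m : ℝ)) * ∑ j, g (S j) + 2 * e + η := by
  have hm0 : (0 : ℝ) < m := by exact_mod_cast hm
  have h4 : ∫ ω, g ω ∂μ ≤ ∫ ω, (g' ω + e) ∂μ :=
    integral_mono_ae hg (hg'.add (integrable_const _)) h1
  rw [integral_add hg' (integrable_const _)] at h4
  simp only [integral_const, probReal_univ, one_smul] at h4
  have h5 : (1 / (m : ℝ)) * ∑ j, g' (S j) ≤ (1 / (m : ℝ)) * ∑ j, g (S j) + e := by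
    have h6 : ∑ j, g' (S j) ≤ ∑ j, (g (S j) + e) := Finset.sum_le_sum fun j _ => h2 j
    have h7 := mul_le_mul_of_nonneg_left h6 (by positivity : 0 ≤ 1 / (m : ℝ))
    refine h7.trans (le_of_eq ?_)
    simp only [Finset.sum_add_distrib, Finset.sum_const, Finset.card_univ, Fintype.card_fin,
      nsmul_eq_mul]
    field_simp
  linarith

/-- Error of replacing a slope `s` and margin `M` by rounded versions `r ≤ s` and `M'`. The
hypothesis `1 ≤ s` absorbs the slope-rounding error `b` into `s b`. -/
theorem abs_mul_sub_mul_le {s r M M' b : ℝ} (hs : 1 ≤ s) (hb : 0 ≤ b) (hr0 : 0 ≤ r) (hrs : r ≤ s)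
    (hsr : s - r ≤ b) (hM : |M| ≤ 1) (hMM : |M - M'| ≤ b) : |s * M - r * M'| ≤ 2 * s * b := by
  have e : s * M - r * M' = (s - r) * M + r * (M - M') := by ring
  rw [e]
  refine (abs_add_le _ _).trans ?_
  rw [abs_mul, abs_mul, abs_of_nonneg hr0, abs_of_nonneg (by linarith : 0 ≤ s - r)]
  have h1 : (s - r) * |M| ≤ b * 1 := mul_le_mul hsr hM (abs_nonneg _) hb
  have h2 : r * |M - M'| ≤ s * b := mul_le_mul hrs hMM (abs_nonneg _) (by linarith)
  nlinarith

/-- For `s ≤ 1`, the ramp of slope `s` is an affine function of the ramp of slope `1`. -/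
theorem clip_one_sub_mul {s M : ℝ} (hs0 : 0 ≤ s) (hs1 : s ≤ 1) (hM : |M| ≤ 1) :
    clip (1 - s * M) = (1 - s) + s * clip (1 - M) := by
  have hM1 := (abs_le.1 hM).2
  rcases le_total M 0 with h | h
  · rw [clip_eq_one (by nlinarith), clip_eq_one (by linarith)]
    ring
  · rw [clip_eq_self (by nlinarith) (by nlinarith), clip_eq_self (by linarith) (by linarith)]
    ring

theorem integrable_clip {Ω : Type*} [MeasurableSpace Ω] {μ : Measure Ω} [IsFiniteMeasure μ]
    {g : Ω → ℝ} (hg : Measurable g) : Integrable (fun ω => clip (g ω)) μ :=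
  Integrable.of_mem_Icc 0 1 (continuous_clip.measurable.comp hg).aemeasurable
    (ae_of_all _ fun _ => clip_mem_Icc _)

end Reduction

/-! ### Classification error and empirical risk in terms of `clip` -/

section Risk

variable {d K T t : ℕ}

/-- The margin of `f` at time `t`, as a function of the labelled sequence. -/
noncomputable def seqMargin (h1 : 1 ≤ t) (ht : t ≤ T)
    (f : (Fin t → EuclideanSpace ℝ (Fin d)) → Fin K → ℝ) (ω : LabeledSeq d K T) : ℝ :=
  margin (f (firstInputs ht ω)) (labelAt h1 ht ω)

theorem measurable_seqMargin (h1 : 1 ≤ t) (ht : t ≤ T)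
    {f : (Fin t → EuclideanSpace ℝ (Fin d)) → Fin K → ℝ} (hf : Measurable f) :
    Measurable (seqMargin h1 ht f) :=
  measurable_margin.comp
    ((hf.comp (measurable_firstInputs ht)).prodMk (measurable_labelAt h1 ht))

theorem errorProb_le_integral (h1 : 1 ≤ t) (ht : t ≤ T) {μ : Measure (LabeledSeq d K T)}
    [IsProbabilityMeasure μ] {φ : (Fin K → ℝ) → Fin K} (hφ : IsArgmaxRule φ)
    {f : (Fin t → EuclideanSpace ℝ (Fin d)) → Fin K → ℝ} (hf : Measurable f) {c : ℝ}
    (hc : 0 ≤ c) :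
    errorProb h1 ht μ φ f ≤ ∫ ω, clip (1 - c * seqMargin h1 ht f ω) ∂μ := by
  have hM := measurable_seqMargin h1 ht hf
  have hs : MeasurableSet {ω | seqMargin h1 ht f ω ≤ 0} := measurableSet_le hM measurable_const
  calc errorProb h1 ht μ φ f ≤ μ.real {ω | seqMargin h1 ht f ω ≤ 0} :=
        -- The rule `φ` need not be measurable; monotonicity of the measure holds for arbitrary
        -- sets.
        measureReal_mono fun ω hω => margin_nonpos_of_argmax_ne hφ hω
    _ = ∫ ω, Set.indicator {ω | seqMargin h1 ht f ω ≤ 0} 1 ω ∂μ := (integral_indicator_one hs).symm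
    _ ≤ _ := by
        refine integral_mono ((integrable_const (1 : ℝ)).indicator hs)
          (integrable_clip ((hM.const_mul _).const_sub _)) fun ω => ?_
        by_cases h : seqMargin h1 ht f ω ≤ 0
        · rw [Set.indicator_of_mem (by exact h), clip_eq_one (by nlinarith)]
          simp
        · rw [Set.indicator_of_notMem (by exact h)]
          exact (clip_mem_Icc _).1

theorem empRampRisk_eq {m : ℕ} (h1 : 1 ≤ t) (ht : t ≤ T) {γ : ℝ} (hγ : 0 < γ)
    (f : (Fin t → EuclideanSpace ℝ (Fin d)) → Fin K → ℝ) (S : Fin m → LabeledSeq d K T) :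
    empRampRisk h1 ht γ f S =
      (1 / (m : ℝ)) * ∑ i, clip (1 - 1 / γ * seqMargin h1 ht f (S i)) := by
  unfold empRampRisk
  congr 1
  refine Finset.sum_congr rfl fun i _ => ?_
  rw [rampLoss_eq_clip hγ]
  congr 1
  unfold seqMargin
  ring

theorem empRampRisk_nonneg {m : ℕ} (h1 : 1 ≤ t) (ht : t ≤ T) {γ : ℝ} (hγ : 0 < γ)
    (f : (Fin t → EuclideanSpace ℝ (Fin d)) → Fin K → ℝ) (S : Fin m → LabeledSeq d K T) :
    0 ≤ empRampRisk h1 ht γ f S := by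
  rw [empRampRisk_eq h1 ht hγ]
  exact mul_nonneg (by positivity) (Finset.sum_nonneg fun i _ => (clip_mem_Icc _).1)

end Risk

/-! ### Size of the net and numerical estimates -/

section Numeric

theorem sum_inv_mul_succ_le_one (T : ℕ) :
    ∑ t : Fin T, (((t : ℝ) + 1) * ((t : ℝ) + 2))⁻¹ ≤ 1 := by
  have h : ∀ n : ℕ, ∑ t ∈ Finset.range n, (((t : ℝ) + 1) * ((t : ℝ) + 2))⁻¹ =
      1 - 1 / ((n : ℝ) + 1) := by
    intro n
    induction n with
    | zero => simp
    | succ n ih =>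
      rw [Finset.sum_range_succ, ih]
      push_cast
      have : (n : ℝ) + 1 ≠ 0 := by positivity
      have : (n : ℝ) + 2 ≠ 0 := by positivity
      have : (n : ℝ) + 1 + 1 ≠ 0 := by positivity
      field_simp
      ring
  rw [Fin.sum_univ_eq_sum_range (fun t : ℕ => (((t : ℝ) + 1) * ((t : ℝ) + 2))⁻¹) T, h]
  have : 0 ≤ 1 / ((T : ℝ) + 1) := by positivity
  linarith

/-- The weight of a net element at time `t` in the union bound. -/
noncomputable def netWeight (k m t : ℕ) : ℝ := (8 * (t : ℝ) * m) ^ (3 * k + 3)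

theorem one_le_netWeight {k m t : ℕ} (hm : 1 ≤ m) (ht : 1 ≤ t) : 1 ≤ netWeight k m t := by
  have h1 : (1 : ℝ) ≤ m := by exact_mod_cast hm
  have h2 : (1 : ℝ) ≤ t := by exact_mod_cast ht
  exact one_le_pow₀ (by nlinarith)

/-- The first factor counts triples of grid kernels with `n = 2 t m` times the slopes `0, 1/m, …,
m`. The extra `t (t + 1)` makes the failure probabilities summable over all times. -/
theorem netCard_mul_le_netWeight {k m t : ℕ} (hm : 1 ≤ m) (ht : 1 ≤ t) :
    (((2 * (2 * t * m) + 1) ^ k) ^ 3 * (m ^ 2 + 1) : ℝ) * (t * (t + 1)) ≤ netWeight k m t := by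
  have h1 : (1 : ℝ) ≤ m := by exact_mod_cast hm
  have h2 : (1 : ℝ) ≤ t := by exact_mod_cast ht
  have h3 : (1 : ℝ) ≤ t * m := by nlinarith
  unfold netWeight
  rw [← pow_mul, pow_add, mul_comm 3 k, mul_assoc]
  refine mul_le_mul (pow_le_pow_left₀ (by positivity) (by nlinarith) _) ?_
    (by positivity) (by positivity)
  have h4 : ((m : ℝ) ^ 2 + 1) * (t * (t + 1)) ≤ (2 * m ^ 2) * (2 * t ^ 2) :=
    mul_le_mul (by nlinarith) (by nlinarith) (by positivity) (by positivity)
  have h5 : ((t : ℝ) * m) ^ 2 ≤ (t * m) ^ 3 := pow_le_pow_right₀ h3 (by norm_num)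
  have h6 : (0 : ℝ) ≤ (t * m) ^ 3 := by positivity
  calc _ ≤ _ := h4
    _ = 4 * ((t : ℝ) * m) ^ 2 := by ring
    _ ≤ 512 * ((t : ℝ) * m) ^ 3 := by linarith
    _ = _ := by ring

theorem two_le_mul_sqrt {d m t : ℕ} (hd : 2 ≤ d) (hm : 1 ≤ m) (ht : 1 ≤ t) :
    2 ≤ (d : ℝ) * t * √m := by
  have h1 : (1 : ℝ) ≤ √m := Real.one_le_sqrt.2 (by exact_mod_cast hm)
  have h2 : (1 : ℝ) ≤ t := by exact_mod_cast ht
  have h3 : (2 : ℝ) ≤ d := by exact_mod_cast hd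
  have h4 : (2 : ℝ) * 1 ≤ d * t := mul_le_mul h3 h2 zero_le_one (by positivity)
  nlinarith

theorem four_fifths_le_sqrt_log {d m t : ℕ} (hd : 2 ≤ d) (hm : 1 ≤ m) (ht : 1 ≤ t) :
    4 / 5 ≤ √(Real.log ((d : ℝ) * t * √m)) := by
  have h1 : Real.log 2 ≤ Real.log ((d : ℝ) * t * √m) :=
    Real.log_le_log two_pos (two_le_mul_sqrt hd hm ht)
  refine Real.le_sqrt_of_sq_le ?_
  have := Real.log_two_gt_d9
  norm_num at this ⊢
  linarith

/-- As `d ≥ 2`, `8 t m ≤ (d t √m)³`, and the exponent satisfies `3 k + 3 ≤ 6 k²`, whence `18 = 6 ·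
3`. -/
theorem log_netWeight_le {d k m t : ℕ} (hk : 1 ≤ k) (hd : 2 ≤ d) (hm : 1 ≤ m) (ht : 1 ≤ t) :
    Real.log (netWeight k m t) ≤ 18 * (k : ℝ) ^ 2 * Real.log ((d : ℝ) * t * √m) := by
  have hm0 : (1 : ℝ) ≤ m := by exact_mod_cast hm
  have h1 : (1 : ℝ) ≤ √m := Real.one_le_sqrt.2 hm0
  have h2 : (1 : ℝ) ≤ t := by exact_mod_cast ht
  have h3 : (2 : ℝ) ≤ d := by exact_mod_cast hd
  have hk1 : (1 : ℝ) ≤ k := by exact_mod_cast hk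
  have hle : 8 * (t : ℝ) * m ≤ ((d : ℝ) * t * √m) ^ 3 := by
    rw [mul_pow, mul_pow]
    have a1 : (8 : ℝ) ≤ (d : ℝ) ^ 3 := by
      calc (8 : ℝ) = 2 ^ 3 := by norm_num
        _ ≤ _ := pow_le_pow_left₀ (by norm_num) h3 3
    have a2 : (t : ℝ) ≤ (t : ℝ) ^ 3 := le_self_pow₀ h2 (by norm_num)
    have a3 : (m : ℝ) ≤ √m ^ 3 := by
      calc (m : ℝ) = √m ^ 2 := (Real.sq_sqrt (by positivity)).symm
        _ ≤ _ := pow_le_pow_right₀ h1 (by norm_num)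
    gcongr
  have hlog : Real.log (8 * (t : ℝ) * m) ≤ 3 * Real.log ((d : ℝ) * t * √m) := by
    have h := Real.log_le_log (by positivity) hle
    rwa [Real.log_pow, Nat.cast_ofNat] at h
  have hL : 0 ≤ Real.log ((d : ℝ) * t * √m) :=
    Real.log_nonneg (by linarith [two_le_mul_sqrt hd hm ht])
  unfold netWeight
  rw [Real.log_pow]
  push_cast
  calc (3 * (k : ℝ) + 3) * Real.log (8 * t * m)
      ≤ (6 * (k : ℝ) ^ 2) * (3 * Real.log ((d : ℝ) * t * √m)) :=
        mul_le_mul (by nlinarith) hlog (Real.log_nonneg (by nlinarith)) (by positivity)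
    _ = _ := by ring

theorem sqrt_log_netWeight_le {d k m t : ℕ} (hk : 1 ≤ k) (hd : 2 ≤ d) (hm : 1 ≤ m) (ht : 1 ≤ t)
    {δ : ℝ} (hδ0 : 0 < δ) (hδ1 : δ < 1) :
    √(Real.log (netWeight k m t / δ) / (2 * m)) ≤
      3 * (k * √(Real.log ((d : ℝ) * t * √m)) / √m) + √(Real.log (1 / δ) / m) := by
  have hm0 : (0 : ℝ) < m := by exact_mod_cast hm
  have hL : 0 ≤ Real.log ((d : ℝ) * t * √m) :=
    Real.log_nonneg (by linarith [two_le_mul_sqrt hd hm ht])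
  have hδ : 0 ≤ Real.log (1 / δ) := Real.log_nonneg ((one_le_div hδ0).2 hδ1.le)
  have hW := log_netWeight_le hk hd hm ht
  have hW0 : (0 : ℝ) < netWeight k m t := zero_lt_one.trans_le (one_le_netWeight hm ht)
  set L := Real.log ((d : ℝ) * t * √m)
  refine Real.sqrt_le_iff.2 ⟨by positivity, ?_⟩
  have e1 : Real.log (netWeight k m t / δ) = Real.log (netWeight k m t) + Real.log (1 / δ) := by
    rw [← Real.log_mul hW0.ne' (by positivity), mul_one_div]
  have h1 : (3 * (k * √L / √m)) ^ 2 = 9 * k ^ 2 * L / m := by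
    rw [mul_pow, div_pow, mul_pow, Real.sq_sqrt hL, Real.sq_sqrt hm0.le]
    ring
  have h2 : √(Real.log (1 / δ) / m) ^ 2 = Real.log (1 / δ) / m := Real.sq_sqrt (by positivity)
  have h3 : 0 ≤ 3 * (k * √L / √m) * √(Real.log (1 / δ) / m) := by positivity
  have h4 : Real.log (netWeight k m t / δ) / (2 * m) ≤ 9 * k ^ 2 * L / m + Real.log (1 / δ) / m := by
    rw [e1, ← add_div, div_le_div_iff₀ (by positivity) hm0]
    nlinarith
  nlinarith

end Numeric

/-! ### Uniform convergence over all networks and slopes -/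

section UniformConvergence

variable {d k K T m p t : ℕ} {A : Fin K → Finset (Fin d)} {σh σy : ℝ → ℝ}

/-- Indices of the triples of grid kernels. -/
abbrev GridTriple (k n : ℕ) : Type :=
  (Fin k → Fin (2 * n + 1)) × (Fin k → Fin (2 * n + 1)) × (Fin k → Fin (2 * n + 1))

/-- The output of the network whose averaged filters are the grid kernels indexed by `a`. -/
noncomputable def gridOutput (p : ℕ) (A : Fin K → Finset (Fin d)) (σh σy : ℝ → ℝ) {n : ℕ}
    (a : GridTriple k n) (t : ℕ) : (Fin t → EuclideanSpace ℝ (Fin d)) → Fin K → ℝ :=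
  output p A σh σy (constFilter (gridFilter n a.1)) (constFilter (gridFilter n a.2.1))
    (constFilter (gridFilter n a.2.2)) t

theorem measurable_of_mem_convRNNClass (hσh : LipschitzWith 1 σh) (hσy : LipschitzWith 1 σy)
    {f : (Fin t → EuclideanSpace ℝ (Fin d)) → Fin K → ℝ} (hf : f ∈ convRNNClass k p A σh σy t) :
    Measurable f := by
  obtain ⟨U, V, W, -, -, -, rfl⟩ := hf
  exact (continuous_output hσh hσy U V W t).measurable

theorem abs_apply_le_of_mem_convRNNClass (hA : ∀ j, (A j).Nonempty)
    (hσh : LipschitzWith 1 σh) (hh0 : σh 0 = 0) (hσy : LipschitzWith 1 σy) (hy0 : σy 0 = 0)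
    {f : (Fin t → EuclideanSpace ℝ (Fin d)) → Fin K → ℝ} (hf : f ∈ convRNNClass k p A σh σy t)
    {B : ℝ} (hB : 0 ≤ B) {X : Fin t → EuclideanSpace ℝ (Fin d)} (hX : ∀ s, ‖X s‖ ≤ B)
    (j : Fin K) : |f X j| ≤ t * B := by
  obtain ⟨U, V, W, hU, hV, hW, rfl⟩ := hf
  exact abs_output_le hA hσh hh0 hσy hy0 (sum_abs_le_one (abs_avgFilter_le hU))
    (sum_abs_le_one (abs_avgFilter_le hV)) (sum_abs_le_one (abs_avgFilter_le hW)) hB hX j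

theorem abs_seqMargin_le (hK : 2 ≤ K) (hA : ∀ j, (A j).Nonempty) (hσh : LipschitzWith 1 σh)
    (hh0 : σh 0 = 0) (hσy : LipschitzWith 1 σy) (hy0 : σy 0 = 0) (h1 : 1 ≤ t) (ht : t ≤ T)
    {f : (Fin t → EuclideanSpace ℝ (Fin d)) → Fin K → ℝ} (hf : f ∈ convRNNClass k p A σh σy t)
    {B : ℝ} (hB : 0 ≤ B) {ω : LabeledSeq d K T} (hω : ∀ s : Fin T, ‖(ω s).1‖ ≤ B) :
    |seqMargin h1 ht f ω| ≤ 2 * B * t := by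
  have hX : ∀ i, ‖firstInputs ht ω i‖ ≤ B := fun i => hω _
  refine (abs_margin_le hK (fun j => abs_apply_le_of_mem_convRNNClass hA hσh hh0 hσy hy0 hf
    hB hX j) (labelAt h1 ht ω)).trans (le_of_eq ?_)
  ring

theorem exists_gridOutput_near (hA : ∀ j, (A j).Nonempty) (hσh : LipschitzWith 1 σh)
    (hh0 : σh 0 = 0) (hσy : LipschitzWith 1 σy)
    {f : (Fin t → EuclideanSpace ℝ (Fin d)) → Fin K → ℝ} (hf : f ∈ convRNNClass k p A σh σy t)
    {n : ℕ} (hn : 1 ≤ n) :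
    ∃ a : GridTriple k n, ∀ B : ℝ, 0 ≤ B → ∀ X : Fin t → EuclideanSpace ℝ (Fin d),
      (∀ s, ‖X s‖ ≤ B) → ∀ j, |f X j - gridOutput p A σh σy a t X j| ≤
        2 * (1 / n) * B * t ^ 2 := by
  obtain ⟨U, V, W, hU, hV, hW, rfl⟩ := hf
  obtain ⟨u, hu⟩ := exists_gridFilter_near hn (abs_avgFilter_le hU)
  obtain ⟨v, hv⟩ := exists_gridFilter_near hn (abs_avgFilter_le hV)
  obtain ⟨w, hw⟩ := exists_gridFilter_near hn (abs_avgFilter_le hW)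
  refine ⟨(u, v, w), fun B hB X hX j => ?_⟩
  refine abs_output_sub_le hA hσh hh0 hσy (sum_abs_le_one (abs_avgFilter_le hU))
    (sum_abs_le_one (abs_avgFilter_le hV)) (sum_abs_le_one (abs_avgFilter_le hW))
    ?_ ?_ (by positivity) ?_ ?_ ?_ hB hX j <;> rw [avgFilter_constFilter]
  · exact sum_abs_le_one (abs_gridFilter_le hn u)
  · exact sum_abs_le_one (abs_gridFilter_le hn w)
  · exact hu
  · exact hv
  · exact hw

/-- The truncated loss of the grid network indexed by `q.1`, with margins normalized by `2 B t` and
slope `q.2 / m`. -/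
noncomputable def gridLoss (p : ℕ) (A : Fin K → Finset (Fin d)) (σh σy : ℝ → ℝ) (B : ℝ)
    (h1 : 1 ≤ t) (ht : t ≤ T) (q : GridTriple k (2 * t * m) × Fin (m ^ 2 + 1))
    (ω : LabeledSeq d K T) : ℝ :=
  clip (1 - (q.2 : ℕ) / (m : ℝ) *
    (seqMargin h1 ht (gridOutput p A σh σy q.1 t) ω / (2 * B * t)))

theorem measurable_gridLoss (hσh : LipschitzWith 1 σh) (hσy : LipschitzWith 1 σy) (B : ℝ)
    (h1 : 1 ≤ t) (ht : t ≤ T) (q : GridTriple k (2 * t * m) × Fin (m ^ 2 + 1)) :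
    Measurable (gridLoss p A σh σy B h1 ht q) :=
  continuous_clip.measurable.comp ((((measurable_seqMargin h1 ht
    (continuous_output hσh hσy _ _ _ t).measurable).div_const _).const_mul _).const_sub _)

/-- Kernel resolution `1/(2 t m)` moves the normalized margin by at most `1/m`, and rounding the
slope down to a multiple of `1/m` has the same precision. The loss then changes by at most `2 s /
m`, once in the expectation and once in the empirical mean. -/
theorem integral_clip_le_of_one_le (hK : 2 ≤ K) (hm : 1 ≤ m) (hA : ∀ j, (A j).Nonempty)
    (hσh : LipschitzWith 1 σh) (hh0 : σh 0 = 0) (hσy : LipschitzWith 1 σy) (hy0 : σy 0 = 0)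
    {B : ℝ} (hB : 0 < B) {μ : Measure (LabeledSeq d K T)} [IsProbabilityMeasure μ]
    (hμ : ∀ᵐ ω ∂μ, ∀ s : Fin T, ‖(ω s).1‖ ≤ B) (h1 : 1 ≤ t) (ht : t ≤ T)
    {S : Fin m → LabeledSeq d K T} (hS : ∀ i s, ‖(S i s).1‖ ≤ B) {η : ℝ}
    (hη : ∀ q : GridTriple k (2 * t * m) × Fin (m ^ 2 + 1),
      ∫ ω, gridLoss p A σh σy B h1 ht q ω ∂μ ≤
        (1 / (m : ℝ)) * ∑ i, gridLoss p A σh σy B h1 ht q (S i) + η)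
    {f : (Fin t → EuclideanSpace ℝ (Fin d)) → Fin K → ℝ} (hf : f ∈ convRNNClass k p A σh σy t)
    {s : ℝ} (hs1 : 1 ≤ s) (hsm : s ≤ m) :
    ∫ ω, clip (1 - s * (seqMargin h1 ht f ω / (2 * B * t))) ∂μ ≤
      (1 / (m : ℝ)) * ∑ i, clip (1 - s * (seqMargin h1 ht f (S i) / (2 * B * t))) +
        4 * s / m + η := by
  have hm0 : (0 : ℝ) < m := by exact_mod_cast hm
  have ht0 : (0 : ℝ) < t := by exact_mod_cast h1
  have hn : 1 ≤ 2 * t * m := Nat.mul_pos (Nat.mul_pos two_pos h1) hm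
  obtain ⟨a, ha⟩ := exists_gridOutput_near hA hσh hh0 hσy hf hn
  have hsm0 : 0 ≤ s * m := by positivity
  have hfl : ⌊s * m⌋₊ ≤ m ^ 2 := Nat.floor_le_of_le (by push_cast; nlinarith)
  set q : GridTriple k (2 * t * m) × Fin (m ^ 2 + 1) := (a, ⟨⌊s * m⌋₊, Nat.lt_succ_of_le hfl⟩)
  have near : ∀ ω : LabeledSeq d K T, (∀ s : Fin T, ‖(ω s).1‖ ≤ B) →
      |s * (seqMargin h1 ht f ω / (2 * B * t)) - (⌊s * m⌋₊ : ℝ) / m *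
        (seqMargin h1 ht (gridOutput p A σh σy a t) ω / (2 * B * t))| ≤ 2 * s * (1 / m) := by
    intro ω hω
    have hX : ∀ i, ‖firstInputs ht ω i‖ ≤ B := fun i => hω _
    have hfle := Nat.floor_le hsm0
    have hflt := Nat.lt_floor_add_one (s * m)
    refine abs_mul_sub_mul_le hs1 (by positivity) (by positivity) ?_ ?_ ?_ ?_
    · rwa [div_le_iff₀ hm0]
    · rw [sub_le_iff_le_add, ← add_div, le_div_iff₀ hm0]
      linarith
    · rw [abs_div, abs_of_pos (by positivity : 0 < 2 * B * t), div_le_one (by positivity)]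
      exact abs_seqMargin_le hK hA hσh hh0 hσy hy0 h1 ht hf hB.le hω
    · have := abs_margin_sub_margin_le hK (ha B hB.le _ hX) (labelAt h1 ht ω)
      rw [← sub_div, abs_div, abs_of_pos (by positivity : 0 < 2 * B * t),
        div_le_iff₀ (by positivity)]
      unfold seqMargin
      refine this.trans (le_of_eq ?_)
      push_cast
      field_simp
  have hmeas := measurable_seqMargin h1 ht (measurable_of_mem_convRNNClass hσh hσy hf)
  have key := integral_le_empMean_add_of_near hm
    (g := fun ω => clip (1 - s * (seqMargin h1 ht f ω / (2 * B * t))))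
    (g' := gridLoss p A σh σy B h1 ht q) (e := 2 * s * (1 / m)) (S := S)
    (integrable_clip (((hmeas.div_const _).const_mul _).const_sub _))
    (Integrable.of_mem_Icc 0 1 (measurable_gridLoss hσh hσy B h1 ht q).aemeasurable
      (ae_of_all _ fun _ => clip_mem_Icc _))
    (by
      filter_upwards [hμ] with ω hω
      refine (clip_le_add_abs_sub _ _).trans ((add_le_add_iff_left _).2 ?_)
      rw [sub_sub_sub_cancel_left, abs_sub_comm]
      exact near ω hω)
    (by
      intro j
      refine (clip_le_add_abs_sub _ _).trans ((add_le_add_iff_left _).2 ?_)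
      rw [sub_sub_sub_cancel_left]
      exact near _ (hS j))
    (hη q)
  refine key.trans (le_of_eq ?_)
  ring

/-- The part `η` of the deviation is multiplied by `s`, the confidence part `r` is not. For `s ≥ 1`
this only weakens the net bound; for `s ≤ 1` it follows from slope `1` by `clip_one_sub_mul`, whose
constant part `1 - s` cancels between the two sides. -/
theorem integral_clip_le (hK : 2 ≤ K) (hm : 1 ≤ m) (hA : ∀ j, (A j).Nonempty)
    (hσh : LipschitzWith 1 σh) (hh0 : σh 0 = 0) (hσy : LipschitzWith 1 σy) (hy0 : σy 0 = 0)
    {B : ℝ} (hB : 0 < B) {μ : Measure (LabeledSeq d K T)} [IsProbabilityMeasure μ]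
    (hμ : ∀ᵐ ω ∂μ, ∀ s : Fin T, ‖(ω s).1‖ ≤ B) (h1 : 1 ≤ t) (ht : t ≤ T)
    {S : Fin m → LabeledSeq d K T} (hS : ∀ i s, ‖(S i s).1‖ ≤ B) {η r : ℝ} (hη0 : 0 ≤ η)
    (hr0 : 0 ≤ r) (hη : ∀ q : GridTriple k (2 * t * m) × Fin (m ^ 2 + 1),
      ∫ ω, gridLoss p A σh σy B h1 ht q ω ∂μ ≤
        (1 / (m : ℝ)) * ∑ i, gridLoss p A σh σy B h1 ht q (S i) + (η + r))
    {f : (Fin t → EuclideanSpace ℝ (Fin d)) → Fin K → ℝ} (hf : f ∈ convRNNClass k p A σh σy t)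
    {s : ℝ} (hs0 : 0 ≤ s) (hsm : s ≤ m) :
    ∫ ω, clip (1 - s * (seqMargin h1 ht f ω / (2 * B * t))) ∂μ ≤
      (1 / (m : ℝ)) * ∑ i, clip (1 - s * (seqMargin h1 ht f (S i) / (2 * B * t))) +
        s * (4 / m + η) + r := by
  have hm0 : (0 : ℝ) < m := by exact_mod_cast hm
  have ht0 : (0 : ℝ) < t := by exact_mod_cast h1
  rcases le_total 1 s with hs1 | hs1
  · have h := integral_clip_le_of_one_le hK hm hA hσh hh0 hσy hy0 hB hμ h1 ht hS hη hf hs1 hsm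
    have h2 : η ≤ s * η := le_mul_of_one_le_left hη0 hs1
    have h3 : s * (4 / m + η) = 4 * s / m + s * η := by ring
    linarith
  · have h := integral_clip_le_of_one_le hK hm hA hσh hh0 hσy hy0 hB hμ h1 ht hS hη hf le_rfl
      (by exact_mod_cast hm)
    have hbd : ∀ ω : LabeledSeq d K T, (∀ s : Fin T, ‖(ω s).1‖ ≤ B) →
        |seqMargin h1 ht f ω / (2 * B * t)| ≤ 1 := by
      intro ω hω
      rw [abs_div, abs_of_pos (by positivity : 0 < 2 * B * t), div_le_one (by positivity)]
      exact abs_seqMargin_le hK hA hσh hh0 hσy hy0 h1 ht hf hB.le hω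
    have hmeas := measurable_seqMargin h1 ht (measurable_of_mem_convRNNClass hσh hσy hf)
    have hint : Integrable (fun ω => clip (1 - seqMargin h1 ht f ω / (2 * B * t))) μ :=
      integrable_clip ((hmeas.div_const _).const_sub _)
    simp only [one_mul] at h
    have e1 : ∫ ω, clip (1 - s * (seqMargin h1 ht f ω / (2 * B * t))) ∂μ =
        (1 - s) + s * ∫ ω, clip (1 - seqMargin h1 ht f ω / (2 * B * t)) ∂μ := by
      rw [integral_congr_ae (g := fun ω => (1 - s) +
        s * clip (1 - seqMargin h1 ht f ω / (2 * B * t)))]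
      · rw [integral_add (integrable_const _) (hint.const_mul s), integral_const_mul]
        simp
      · filter_upwards [hμ] with ω hω using clip_one_sub_mul hs0 hs1 (hbd ω hω)
    have e2 : (1 / (m : ℝ)) * ∑ i, clip (1 - s * (seqMargin h1 ht f (S i) / (2 * B * t))) =
        (1 - s) + s * ((1 / (m : ℝ)) * ∑ i, clip (1 - seqMargin h1 ht f (S i) / (2 * B * t))) := by
      rw [Finset.sum_congr rfl fun i _ => clip_one_sub_mul hs0 hs1 (hbd _ (hS i)),
        Finset.sum_add_distrib, ← Finset.mul_sum]
      simp only [Finset.sum_const, Finset.card_univ, Fintype.card_fin, nsmul_eq_mul]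
      field_simp
    rw [e1, e2]
    have h2 := mul_le_mul_of_nonneg_left h hs0
    have h3 : s * r ≤ r := mul_le_of_le_one_left hr0 hs1
    have h4 : s * (4 * 1 / (m : ℝ)) = s * (4 / m) := by ring
    nlinarith

theorem sum_inv_netWeight_le_one (hm : 1 ≤ m) :
    ∑ q : (Σ t : Fin T, GridTriple k (2 * ((t : ℕ) + 1) * m) × Fin (m ^ 2 + 1)),
      (netWeight k m ((q.1 : ℕ) + 1))⁻¹ ≤ 1 := by
  rw [Fintype.sum_sigma]
  refine le_trans (Finset.sum_le_sum fun t _ => ?_) (sum_inv_mul_succ_le_one T)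
  have h := netCard_mul_le_netWeight (k := k) hm (Nat.le_add_left 1 (t : ℕ))
  have hW : 0 < netWeight k m ((t : ℕ) + 1) :=
    zero_lt_one.trans_le (one_le_netWeight hm (Nat.le_add_left 1 (t : ℕ)))
  simp only [Finset.sum_const, Finset.card_univ, Fintype.card_prod, Fintype.card_fun,
    Fintype.card_fin, nsmul_eq_mul]
  rw [← div_eq_mul_inv, div_le_iff₀ hW, inv_mul_eq_div, le_div_iff₀ (by positivity)]
  refine le_trans (le_of_eq ?_) h
  push_cast
  ring

/-- With high probability the sample is bounded, and all grid losses at all times have empirical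
means close to their expectations. -/
theorem exists_net_event (hm : 1 ≤ m) (hσh : LipschitzWith 1 σh) (hσy : LipschitzWith 1 σy)
    {B : ℝ} {μ : Measure (LabeledSeq d K T)} [IsProbabilityMeasure μ]
    (hμ : ∀ᵐ ω ∂μ, ∀ s : Fin T, ‖(ω s).1‖ ≤ B) {δ : ℝ} (hδ0 : 0 < δ) (hδ1 : δ < 1) :
    ∃ E : Set (Fin m → LabeledSeq d K T), MeasurableSet E ∧
      1 - δ ≤ (Measure.pi fun _ : Fin m => μ).real E ∧
      ∀ S ∈ E, (∀ i s, ‖(S i s).1‖ ≤ B) ∧ ∀ (t : ℕ) (h1 : 1 ≤ t) (ht : t ≤ T)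
        (q : GridTriple k (2 * t * m) × Fin (m ^ 2 + 1)),
        ∫ ω, gridLoss p A σh σy B h1 ht q ω ∂μ ≤
          (1 / (m : ℝ)) * ∑ i, gridLoss p A σh σy B h1 ht q (S i) +
            √(Real.log (netWeight k m t / δ) / (2 * m)) := by
  obtain ⟨E, hE, hEδ, hES⟩ := exists_uniform_deviation_event μ hm
    (ι := Σ t : Fin T, GridTriple k (2 * ((t : ℕ) + 1) * m) × Fin (m ^ 2 + 1))
    (g := fun q => gridLoss p A σh σy B (Nat.le_add_left 1 _) q.1.2 q.2)
    (fun q => measurable_gridLoss hσh hσy B _ _ q.2) (fun q _ => clip_mem_Icc _)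
    (q := fun q => netWeight k m ((q.1 : ℕ) + 1))
    (fun q => one_le_netWeight hm (Nat.le_add_left 1 _)) (sum_inv_netWeight_le_one hm) hδ0 hδ1
  set F : Set (Fin m → LabeledSeq d K T) := {S | ∀ i s, ‖(S i s).1‖ ≤ B}
  have hF : MeasurableSet F := by
    simp only [F, Set.ofPred_forall]
    refine MeasurableSet.iInter fun i => MeasurableSet.iInter fun s => ?_
    refine measurableSet_le (Measurable.norm ?_) measurable_const
    exact measurable_fst.comp ((measurable_pi_apply s).comp (measurable_pi_apply i))
  have hFae : ∀ᵐ S ∂(Measure.pi fun _ : Fin m => μ), S ∈ F := by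
    refine ae_all_iff.2 fun i => ?_
    exact (measurePreserving_eval (fun _ : Fin m => μ) i).quasiMeasurePreserving.ae hμ
  refine ⟨E ∩ F, hE.inter hF, hEδ.trans (le_of_eq ?_), fun S hS => ⟨hS.2, fun t h1 ht q => ?_⟩⟩
  · refine measureReal_congr ?_
    filter_upwards [hFae] with S hS
    exact propext ⟨fun h => ⟨h, hS⟩, fun h => h.1⟩
  -- The index `t : Fin T` of the net stands for time `t + 1`.
  · obtain ⟨t, rfl⟩ := Nat.exists_eq_add_of_le' h1
    exact hES S hS.1 ⟨⟨t, ht⟩, q⟩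

/-- For null inputs all margins vanish. -/
theorem empRampRisk_eq_one (hK : 2 ≤ K) (hm : 1 ≤ m) (hA : ∀ j, (A j).Nonempty)
    (hσh : LipschitzWith 1 σh) (hh0 : σh 0 = 0) (hσy : LipschitzWith 1 σy) (hy0 : σy 0 = 0)
    (h1 : 1 ≤ t) (ht : t ≤ T) {S : Fin m → LabeledSeq d K T} (hS : ∀ i s, ‖(S i s).1‖ ≤ 0)
    {f : (Fin t → EuclideanSpace ℝ (Fin d)) → Fin K → ℝ} (hf : f ∈ convRNNClass k p A σh σy t)
    {γ : ℝ} (hγ : 0 < γ) : empRampRisk h1 ht γ f S = 1 := by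
  have hm0 : (m : ℝ) ≠ 0 := by positivity
  have h0 : ∀ i, seqMargin h1 ht f (S i) = 0 := by
    intro i
    have := abs_seqMargin_le hK hA hσh hh0 hσy hy0 h1 ht hf le_rfl (hS i)
    rw [mul_zero, zero_mul] at this
    exact abs_nonpos_iff.1 this
  rw [empRampRisk_eq h1 ht hγ]
  simp [h0, clip_eq_one, hm0]

end UniformConvergence

end ConvRNN

/-! ### The generalization bound -/

theorem theorem6 :
    ∃ C : ℝ, 0 < C ∧
      ∀ (d k K T m p : ℕ), 1 ≤ k → k ≤ d → 2 ≤ K → K ≤ d → 1 ≤ m → p < k →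
      ∀ (A : Fin K → Finset (Fin d)), (∀ j, (A j).Nonempty) →
      ∀ (σh σy : ℝ → ℝ), LipschitzWith 1 σh → LipschitzWith 1 σy → σh 0 = 0 → σy 0 = 0 →
        (∀ v, |σh v| ≤ 1) →
      ∀ (Bx : ℝ), 0 ≤ Bx →
      ∀ (μ : Measure (ConvRNN.LabeledSeq d K T)) [IsProbabilityMeasure μ],
        (∀ᵐ ω ∂μ, ∀ s : Fin T, ‖(ω s).1‖ ≤ Bx) →
      ∀ (δ : ℝ), 0 < δ → δ < 1 →
      ∃ E : Set (Fin m → ConvRNN.LabeledSeq d K T), MeasurableSet E ∧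
        1 - δ ≤ (Measure.pi fun _ : Fin m => μ).real E ∧
        ∀ S ∈ E, ∀ (t : ℕ) (h1 : 1 ≤ t) (ht : t ≤ T) (γ : ℝ), 0 < γ →
          ∀ f ∈ ConvRNN.convRNNClass k p A σh σy t,
          ∀ φ : (Fin K → ℝ) → Fin K, ConvRNN.IsArgmaxRule φ →
            ConvRNN.errorProb h1 ht μ φ f ≤
              ConvRNN.empRampRisk h1 ht γ f S +
                C * (Bx * (k : ℝ) * (t : ℝ) * √(Real.log ((d : ℝ) * (t : ℝ) * √(m : ℝ))) /
                      (√(m : ℝ) * γ) +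
                    √(Real.log (1 / δ) / (m : ℝ))) := by
  open ConvRNN in
  -- The net error `4/m ≤ 5 k L / √m` and the deviation `3 k L / √m` add up to `8 s k L / √m`, which
  -- is `16` times the complexity term `s (k L / √m) / 2`.
  refine ⟨16, by norm_num, ?_⟩
  intro d k K T m p hk _ hK hKd hm _ A hA σh σy hσh hσy hh0 hy0 _ B hB μ _ hμ δ hδ0 hδ1
  obtain ⟨E, hE, hEδ, hES⟩ := exists_net_event (k := k) (p := p) (A := A) hm hσh hσy hμ hδ0 hδ1
  refine ⟨E, hE, hEδ, fun S hS t h1 ht γ hγ f hf φ hφ => ?_⟩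
  obtain ⟨hSB, hnet⟩ := hES S hS
  have hd : 2 ≤ d := hK.trans hKd
  have hm1 : (1 : ℝ) ≤ m := by exact_mod_cast hm
  have hm0 : (0 : ℝ) < m := by linarith
  have ht0 : (0 : ℝ) < t := by exact_mod_cast h1
  have hk1 : (1 : ℝ) ≤ k := by exact_mod_cast hk
  have hsm : (1 : ℝ) ≤ √m := Real.one_le_sqrt.2 hm1
  have hsm0 : 0 < √(m : ℝ) := by linarith
  have hsq : √(m : ℝ) * √m = m := Real.mul_self_sqrt hm0.le
  have hperr : errorProb h1 ht μ φ f ≤ 1 := measureReal_le_one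
  have hL := four_fifths_le_sqrt_log hd hm h1
  have hdev := sqrt_log_netWeight_le hk hd hm h1 hδ0 hδ1
  set L := √(Real.log ((d : ℝ) * t * √m))
  set R := √(Real.log (1 / δ) / (m : ℝ))
  have hR : 0 ≤ R := Real.sqrt_nonneg _
  have hkL : 4 / 5 ≤ k * L := by nlinarith
  rcases hB.eq_or_lt with rfl | hB
  · rw [empRampRisk_eq_one hK hm hA hσh hh0 hσy hy0 h1 ht hSB hf hγ]
    have : 0 ≤ 16 * (0 * (k : ℝ) * t * L / (√m * γ) + R) := by simpa using hR
    linarith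
  · set s : ℝ := 2 * B * t / γ with hs
    have hs0 : 0 ≤ s := by positivity
    have hterm : B * k * t * L / (√m * γ) = s * (k * L / √m) / 2 := by
      rw [hs]
      field_simp
    have hfourm : 4 / (m : ℝ) ≤ 5 * (k * L / √m) := by
      rw [← mul_div_assoc, div_le_div_iff₀ hm0 hsm0]
      nlinarith
    have hkLm : 0 ≤ k * L / √(m : ℝ) := by positivity
    rw [hterm]
    rcases le_or_gt s m with hsm' | hsm'
    · have hnet' := fun q => (hnet t h1 ht q).trans ((add_le_add_iff_left _).2 hdev)
      have h := integral_clip_le hK hm hA hσh hh0 hσy hy0 hB hμ h1 ht hSB (by positivity) hR hnet'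
        hf hs0 hsm'
      have hrw : ∀ ω, s * (seqMargin h1 ht f ω / (2 * B * t)) = 1 / γ * seqMargin h1 ht f ω := by
        intro ω
        rw [hs]
        field_simp
      simp only [hrw] at h
      rw [← empRampRisk_eq h1 ht hγ] at h
      have h2 := errorProb_le_integral h1 ht (μ := μ) hφ
        (measurable_of_mem_convRNNClass hσh hσy hf) (c := 1 / γ) (by positivity)
      have h3 := mul_le_mul_of_nonneg_left hfourm hs0
      nlinarith
    -- For `s > m` the complexity term is at least `1/5`, so `16` times it exceeds any probability.
    · have h1' : 1 / 5 ≤ s * (k * L / √m) / 2 := by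
        have h2 : 4 / 5 / √(m : ℝ) ≤ k * L / √m := by gcongr
        have h3 : (m : ℝ) * (4 / 5 / √m) ≤ s * (k * L / √m) :=
          mul_le_mul hsm'.le h2 (by positivity) hs0
        have h4 : (m : ℝ) * (4 / 5 / √m) = 4 / 5 * √m := by
          rw [← mul_div_assoc, div_eq_iff hsm0.ne']
          linarith
        linarith
      have := empRampRisk_nonneg h1 ht hγ f S
      linarith
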